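/- Let $N\ge 1$, let $P_1,\dots,P_N\in\mathbb{R}^2$ with $P_j=(X_1^{(j)},X_2^{(j)})$, and in $\mathbb{C}^2$ with coordinates $(x_1,x_2)$ put $$L_1^{(j)}=\{x_1+ix_2=X_1^{(j)}+iX_2^{(j)}\},\qquad L_2^{(j)}=\{x_1-ix_2=X_1^{(j)}-iX_2^{(j)}\},\qquad T=\bigcup_{j=1}^N\bigl(L_1^{(j)}\cup L_2^{(j)}\bigr).$$ Let $A\in\mathbb{C}^2\setminus T$ and $\varepsilon>0$. Then for each $(\ell,j)\in\{1,2\}\times\{1,\dots,N\}$ there are a point $B_{\ell,j}\in\mathbb{C}^2\setminus T$, a path $\gamma_{\ell,j}$ in $\mathbb{C}^2\setminus T$ from $A$ to $B_{\ell,j}$, and a closed path $\sigma^*_{\ell,j}$ in $\mathbb{C}^2\setminus T$ based at $B_{\ell,j}$ such that, with $\sigma_{\ell,j}=\gamma_{\ell,j}\,\sigma^*_{\ell,j}\,\gamma_{\ell,j}^{-1}$, the following hold. 1. $\sigma^*_{\ell,j}$ is a small meridian around $L_\ell^{(j)}$: along it the transversal coordinate $x_1+ix_2-(X_1^{(j)}+iX_2^{(j)})$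 if $\ell=1$ (respectively $x_1-ix_2-(X_1^{(j)}-iX_2^{(j)})$ if $\ell=2$) runs once, in the positive direction, around a circle centred at $0$ of radius $r_{\ell,j}\in(0,\varepsilon)$ with $r_{\ell,j}<|P_j-P_k|$ whenever $P_k\ne P_j$, while the other coordinate $x_1-ix_2$ (respectively $x_1+ix_2$) is constant. 2. On the whole of $\sigma_{1,j}$ the quantity $x_1-ix_2$ is constant, and on the whole of $\sigma_{2,j}$ the quantity $x_1+ix_2$ is constant. 3. For every closed path $\sigma$ in $\mathbb{C}^2\setminus T$ based at $A$ there are a positive integer $H$, indices $\alpha_1,\dots,\alpha_H\in\{1,2\}\times\{1,\dots,N\}$ and integers $m_1,\dots,m_H\in\mathbb{Z}$ such that $\sigma$ is homotopic in $\mathbb{C}^2\setminus T$, with the base point $A$ fixed, to the concatenation $\sigma_{\alpha_1}^{m_1}\sigma_{\alpha_2}^{m_2}\cdots\sigma_{\alpha_H}^{m_H}$. -/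

import Mathlib

namespace ContourRep

/-- The characteristic coordinates on `ℂ²`: index `0` gives `x₁ + i x₂` and index `1` gives
`x₁ - i x₂`. -/
noncomputable def charCoord (l : Fin 2) (x : ℂ × ℂ) : ℂ :=
  if l = 0 then x.1 + Complex.I * x.2 else x.1 - Complex.I * x.2

/-- A point of the real plane, seen as a point of `ℂ²`. -/
noncomputable def realPoint (p : ℝ × ℝ) : ℂ × ℂ := ((p.1 : ℂ), (p.2 : ℂ))

/-- The complex lines through the real branch points: `branchLine P 0 j` is
`L₁^{(j)} = {x₁ + i x₂ = X₁^{(j)} + i X₂^{(j)}}` and `branchLine P 1 j` is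
`L₂^{(j)} = {x₁ - i x₂ = X₁^{(j)} - i X₂^{(j)}}`. -/
def branchLine {N : ℕ} (P : Fin N → ℝ × ℝ) (l : Fin 2) (j : Fin N) : Set (ℂ × ℂ) :=
  {x | charCoord l x = charCoord l (realPoint (P j))}

/-- The singular set `T`: the union of all the lines. -/
def branchSet {N : ℕ} (P : Fin N → ℝ × ℝ) : Set (ℂ × ℂ) :=
  ⋃ (l : Fin 2) (j : Fin N), branchLine P l j

/-- The transversal coordinate to the line with index `(l, j)`; it vanishes exactly on it. -/
noncomputable def transversal {N : ℕ} (P : Fin N → ℝ × ℝ) (l : Fin 2) (j : Fin N)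
    (x : ℂ × ℂ) : ℂ :=
  charCoord l x - charCoord l (realPoint (P j))

/-- `c` is a local contour of size less than `ε`, encircling the line with index `(l, j)` once:
the transversal coordinate runs once, in the positive direction, around a circle about `0` of
radius less than `ε`, the tangential coordinate stays constant, and the closed disc bounded by
the circle meets no parallel line of the family other than the given one. -/
def IsMeridian {N : ℕ} (P : Fin N → ℝ × ℝ) (ε : ℝ) (l : Fin 2) (j : Fin N)
    {B : ↥(branchSet P)ᶜ} (c : Path B B) : Prop :=
  ‖transversal P l j B.1‖ < ε ∧
  (∀ k : Fin N, P k ≠ P j →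
    ‖transversal P l j B.1‖ < ‖transversal P l j (realPoint (P k))‖) ∧
  ∀ t : unitInterval,
    transversal P l j (c t).1 =
      transversal P l j B.1 * Complex.exp (2 * Real.pi * Complex.I * ((t : ℝ) : ℂ)) ∧
    charCoord (1 - l) (c t).1 = charCoord (1 - l) B.1

section Paths

variable {X : Type*} [TopologicalSpace X] {x y : X}

/-- The contour `γ c γ⁻¹`. -/
noncomputable def conjLoop (γ : Path x y) (c : Path y y) : Path x x :=
  (γ.trans c).trans γ.symm

/-- Concatenation of a list of loops, in the order of the list (the constant loop if empty). -/
noncomputable def concat : List (Path x x) → Path x x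
  | [] => Path.refl x
  | p :: ps => p.trans (concat ps)

/-- Integer powers of a loop; negative powers run along the reversed loop. -/
noncomputable def loopPow (p : Path x x) : ℤ → Path x x
  | Int.ofNat n => concat (List.replicate n p)
  | Int.negSucc n => concat (List.replicate (n + 1) p.symm)

end Paths

end ContourRep

namespace ContourRep

open Set Filter Topology
open Path.Homotopic (Quotient)
open Path.Homotopic.Quotient (mk)

/-! In the characteristic coordinates `u = x₁ + i x₂`, `v = x₁ - i x₂` the complement of `T` is a
product of two punctured planes. A loop in a product is homotopic to its `u`-component with `v`
frozen, followed by its `v`-component with `u` frozen (`exists_mk_eq_slices`). Hence it suffices to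
generate the loops of a finitely punctured plane by meridians (`exists_meridians_generate`) and to
embed these in the two slices through `A`; one coordinate is then constant along each generator.

In the plane, take a base point `o` on no line through two distinct punctures. Each segment from `o`
then meets at most one puncture, and so does a thin convex neighbourhood of it. Loops in such a
neighbourhood are powers of one meridian: this is read off from lifts through `w ↦ s + exp w`
(`exists_homotopic_loopPow`). A van Kampen type argument (`Generated.of_local`) passes from these
neighbourhoods to all loops, and conjugation by a path moves the base point from `o` to the given
one. -/

/-- The homotopy classes of loops lying in the group generated by the loops `c i`. -/
inductive Generated {X ι : Type*} [TopologicalSpace X] {x : X} (c : ι → Path x x) :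
    Quotient x x → Prop
  | refl : Generated c (Quotient.refl x)
  | of (i : ι) : Generated c (mk (c i))
  | trans {p q : Quotient x x} : Generated c p → Generated c q → Generated c (p.trans q)
  | symm {p : Quotient x x} : Generated c p → Generated c p.symm

/-! ### Calculus of generated loop classes, and the local-to-global principle. -/

section Generated

variable {X ι : Type*} [TopologicalSpace X] {x : X}

theorem trans_symm_cancel {x y z : X} (p : Quotient x y) (q : Quotient x z) :
    p.trans (p.symm.trans q) = q := by
  rw [← Quotient.trans_assoc, Quotient.trans_symm, Quotient.refl_trans]

theorem symm_trans_cancel {x y z : X} (p : Quotient y x) (q : Quotient x z) :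
    p.symm.trans (p.trans q) = q := by
  rw [← Quotient.trans_assoc, Quotient.symm_trans, Quotient.refl_trans]

theorem symm_trans_rev {x y z : X} (p : Quotient x y) (q : Quotient y z) :
    (p.trans q).symm = q.symm.trans p.symm := by
  induction p with | mk p =>
  induction q with | mk q =>
  rw [← Quotient.mk_trans, ← Quotient.mk_symm, Path.trans_symm]
  rfl

theorem symm_symm_quotient {x y : X} (p : Quotient x y) : p.symm.symm = p := by
  induction p with | mk p =>
  rw [← Quotient.mk_symm, ← Quotient.mk_symm, Path.symm_symm]

theorem mk_concat_append (L M : List (Path x x)) :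
    mk (concat (L ++ M)) = (mk (concat L)).trans (mk (concat M)) := by
  induction L with
  | nil => simp [concat]
  | cons p L ih => simp [concat, ih, Quotient.trans_assoc]

theorem mk_concat_symm (L : List (Path x x)) :
    (mk (concat L)).symm = mk (concat (L.map Path.symm).reverse) := by
  induction L with
  | nil => simp only [concat, List.map_nil, List.reverse_nil, ← Quotient.mk_symm, Path.refl_symm]
  | cons p L ih =>
    simp only [concat, List.map_cons, List.reverse_cons, mk_concat_append, Quotient.mk_trans,
      symm_trans_rev, ih, Quotient.mk_symm, Quotient.mk_refl, Quotient.trans_refl]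

theorem mk_loopPow_symm (p : Path x x) (m : ℤ) :
    (mk (loopPow p m)).symm = mk (loopPow p (-m)) := by
  rcases m with (_ | n) | n
  · simp only [loopPow, mk_concat_symm, List.map_replicate, List.reverse_replicate]
    rfl
  · simp only [loopPow, mk_concat_symm, List.map_replicate, List.reverse_replicate]
    rfl
  · simp only [loopPow, mk_concat_symm, List.map_replicate, List.reverse_replicate,
      Path.symm_symm]
    rfl

theorem Generated.loopPow {c : ι → Path x x} {p : Path x x} (hp : Generated c (mk p)) (m : ℤ) :
    Generated c (mk (loopPow p m)) := by
  have key : ∀ (q : Path x x), Generated c (mk q) → ∀ n : ℕ,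
      Generated c (mk (concat (List.replicate n q))) := by
    intro q hq n
    induction n with
    | zero => exact .refl
    | succ n ih => exact hq.trans ih
  rcases m with n | n
  · exact key p hp n
  · exact key p.symm hp.symm (n + 1)

/-- The only case with content is the inverse: reverse the word and negate its exponents. -/
theorem Generated.exists_list {c : ι → Path x x} {q : Quotient x x} (h : Generated c q) :
    ∃ L : List (ι × ℤ), q = mk (concat (L.map fun a => ContourRep.loopPow (c a.1) a.2)) := by
  induction h with
  | refl => exact ⟨[], rfl⟩
  | of i => exact ⟨[(i, 1)], by simp [concat, ContourRep.loopPow]⟩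
  | trans _ _ h₁ h₂ =>
    obtain ⟨L, rfl⟩ := h₁
    obtain ⟨M, rfl⟩ := h₂
    exact ⟨L ++ M, by rw [List.map_append, mk_concat_append]⟩
  | symm hp h =>
    clear hp
    obtain ⟨L, rfl⟩ := h
    refine ⟨(L.map fun a => (a.1, -a.2)).reverse, ?_⟩
    induction L with
    | nil => rfl
    | cons a L ih =>
      simp only [List.map_cons, List.reverse_cons, List.map_append, mk_concat_append, ← ih, concat,
        Quotient.mk_trans, symm_trans_rev, mk_loopPow_symm, List.map_nil, Quotient.mk_refl,
        Quotient.trans_refl]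

theorem Generated.hom {Y κ : Type*} [TopologicalSpace Y] {y : Y} {c : ι → Path x x}
    {d : κ → Path y y} (φ : Quotient x x → Quotient y y) (h₁ : φ (Quotient.refl x) = Quotient.refl y)
    (h₂ : ∀ p q, φ (p.trans q) = (φ p).trans (φ q)) (h₃ : ∀ p, φ p.symm = (φ p).symm)
    (h : ∀ i, Generated d (φ (mk (c i)))) {q : Quotient x x} (hq : Generated c q) :
    Generated d (φ q) := by
  induction hq with
  | refl => exact h₁ ▸ .refl
  | of i => exact h i
  | trans _ _ hp hq => exact h₂ _ _ ▸ hp.trans hq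
  | symm _ hp => exact h₃ _ ▸ hp.symm

/-- Generation half of van Kampen's theorem. Each point `y` is tied to the base point by `p y`; if
short paths, closed up by these ties, are generated, then so are all paths. Instead of subdividing
`σ`, the proof shows that being generated up to time `t` is locally constant in `t`. -/
theorem Generated.of_local {c : ι → Path x x} (p : ∀ y, Path x y)
    (h : ∀ y, ∃ N ∈ 𝓝 y, ∀ (z : X) (f : Path y z), range f ⊆ N →
      Generated c (((mk (p y)).trans (mk f)).trans (mk (p z)).symm))
    {a b : X} (σ : Path a b) :
    Generated c (((mk (p a)).trans (mk σ)).trans (mk (p b)).symm) := by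
  let good : unitInterval → Prop := fun t =>
    Generated c (((mk (p (σ 0))).trans (mk (σ.subpath 0 t))).trans (mk (p (σ t))).symm)
  have hloc : IsLocallyConstant good := by
    rw [IsLocallyConstant.iff_eventually_eq]
    intro t
    obtain ⟨N, hN, hgen⟩ := h (σ t)
    have hpre : σ ⁻¹' N ∈ 𝓝 t := σ.continuous.continuousAt hN
    -- For `t'` near `t` the whole interval between them is mapped by `σ` into `N`, on whichever
    -- side `t'` lies.
    have hI : Tendsto (fun t' => uIcc t t') (𝓝 t) (𝓝 t).smallSets :=
      tendsto_const_nhds.uIcc tendsto_id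
    filter_upwards [hI.eventually (eventually_smallSets_subset.2 hpre)] with t' ht'
    have key := hgen _ (σ.subpath t t') (by rw [Path.range_subpath]; exact image_subset_iff.2 ht')
    have hsub : mk (σ.subpath 0 t') = (mk (σ.subpath 0 t)).trans (mk (σ.subpath t t')) := by
      rw [← Quotient.mk_trans, eq_comm, Path.Homotopic.Quotient.eq]
      exact ⟨Path.Homotopy.subpathTransSubpath σ 0 t t'⟩
    refine propext ⟨fun hg => ?_, fun hg => ?_⟩
    · have := hg.trans key.symm
      simp only [hsub, symm_trans_rev, symm_symm_quotient, Quotient.trans_assoc,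
        symm_trans_cancel, trans_symm_cancel] at this
      simpa only [good, Quotient.trans_assoc] using this
    · have := hg.trans key
      simp only [Quotient.trans_assoc, symm_trans_cancel] at this
      simpa only [good, hsub, Quotient.trans_assoc] using this
  have h0 : good 0 := by
    simp only [good, Path.subpath_self, Quotient.mk_refl, Quotient.trans_refl, Quotient.trans_symm]
    exact .refl
  have h1 : good 1 := (hloc.apply_eq_of_preconnectedSpace 0 1) ▸ h0
  have hcast : ∀ (a' b' : X) (ha : a' = a) (hb : b' = b),
      Generated c (((mk (p a')).trans (mk (σ.cast ha hb))).trans (mk (p b')).symm) →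
      Generated c (((mk (p a)).trans (mk σ)).trans (mk (p b)).symm) := by
    rintro _ _ rfl rfl h
    exact h
  refine hcast _ _ σ.source σ.target ?_
  rw [← Path.subpath_zero_one]
  exact h1

theorem homotopic_of_factor {Y : Type*} [TopologicalSpace Y] [SimplyConnectedSpace Y]
    (e : C(Y, X)) {x y : X} {p q : Path x y} {z w : Y} (P Q : Path z w)
    (hP : ∀ t, e (P t) = p t) (hQ : ∀ t, e (Q t) = q t) : p.Homotopic q := by
  have hz : x = e z := by simpa using (hP 0).symm
  have hw : y = e w := by simpa using (hP 1).symm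
  subst hz hw
  have h := (SimplyConnectedSpace.paths_homotopic P Q).map e
  rwa [show P.map e.continuous = p from Path.ext (funext hP),
    show Q.map e.continuous = q from Path.ext (funext hQ)] at h

theorem mk_conjLoop {y : X} (γ : Path x y) (c : Path y y) :
    mk (conjLoop γ c) = ((mk γ).trans (mk c)).trans (mk γ).symm := by
  simp [conjLoop]

theorem conjLoop_map {Y : Type*} [TopologicalSpace Y] {y : X} (γ : Path x y) (c : Path y y)
    {f : X → Y} (hf : Continuous f) :
    conjLoop (γ.map hf) (c.map hf) = (conjLoop γ c).map hf := by
  simp only [conjLoop, Path.map_trans, Path.map_symm]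

end Generated

/-! ### Star-shaped sets punctured at their centre, via the exponential. -/

section ExpLift

variable {s : ℂ} {U V : Set ℂ}

/-- Decreasing the real part of `w` moves `s + exp w` straight towards the centre `s`. -/
theorem add_exp_sub_mem (hV : StarConvex ℝ s V) {w : ℂ} (hw : s + Complex.exp w ∈ V)
    {τ : ℝ} (hτ : 0 ≤ τ) : s + Complex.exp (w - τ) ∈ V := by
  have h := hV hw (a := 1 - Real.exp (-τ)) (b := Real.exp (-τ))
    (sub_nonneg.2 (Real.exp_le_one_iff.2 (by linarith))) (Real.exp_pos _).le (by ring)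
  convert h using 1
  simp only [Complex.real_smul, sub_eq_add_neg w, Complex.exp_add]
  push_cast
  ring

/-- Translation to the left keeps the preimage stable and deforms it onto a half-plane `re w ≤ r`,
which is convex. -/
theorem simplyConnectedSpace_preimage_exp (hV : StarConvex ℝ s V) {ρ : ℝ} (hρ : 0 < ρ)
    (hb : Metric.ball s ρ ⊆ V) : SimplyConnectedSpace {w : ℂ | s + Complex.exp w ∈ V} := by
  -- With this `r`, the half-plane is mapped into the closed disc of radius `ρ / 2`, hence into the
  -- ball.
  set r := Real.log (ρ / 2)
  let H : Set ℂ := {w | w.re ≤ r}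
  have hHc : Convex ℝ H := convex_halfSpace_re_le r
  have hHne : H.Nonempty := ⟨(r : ℂ), by simp [H]⟩
  have : ContractibleSpace H := hHc.contractibleSpace hHne
  have hHV : ∀ w ∈ H, s + Complex.exp w ∈ V := by
    intro w hw
    apply hb
    rw [Metric.mem_ball, dist_eq_norm, add_sub_cancel_left, Complex.norm_exp]
    calc Real.exp w.re ≤ Real.exp r := Real.exp_le_exp.2 hw
      _ = ρ / 2 := Real.exp_log (by positivity)
      _ < ρ := by linarith
  let f : C({w : ℂ | s + Complex.exp w ∈ V}, H) :=
    ⟨fun w => ⟨w.1 - (max 0 (w.1.re - r) : ℝ), by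
      have := le_max_right 0 (w.1.re - r)
      simp only [H, mem_ofPred_eq, Complex.sub_re, Complex.ofReal_re]
      linarith⟩, by fun_prop⟩
  let g : C(H, {w : ℂ | s + Complex.exp w ∈ V}) :=
    ⟨fun w => ⟨w.1, hHV w.1 w.2⟩, by fun_prop⟩
  have hfg : f.comp g = ContinuousMap.id H := by
    ext w
    have hw : w.1.re - r ≤ 0 := sub_nonpos.2 w.2
    simp [f, g, max_eq_left hw]
  have hgf : (g.comp f).Homotopic (ContinuousMap.id _) := by
    have hmem : ∀ x : unitInterval × {w : ℂ | s + Complex.exp w ∈ V},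
        s + Complex.exp (x.2.1 - ((1 - x.1) * max 0 (x.2.1.re - r) : ℝ)) ∈ V := fun x =>
      add_exp_sub_mem hV x.2.2 (mul_nonneg (sub_nonneg.2 x.1.2.2) (le_max_left _ _))
    refine ⟨⟨⟨fun x => ⟨x.2.1 - ((1 - x.1) * max 0 (x.2.1.re - r) : ℝ), hmem x⟩,
      Continuous.subtype_mk (by fun_prop) _⟩, fun x => ?_, fun x => ?_⟩⟩
    · simp [f, g]
    · simp
  exact ContinuousMap.HomotopyEquiv.simplyConnectedSpace
    (Y := H) ⟨f, g, hgf, by rw [hfg]⟩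

/-- The path `q` runs in `V`, and lifts through `w ↦ s + exp w` to a path from `w` to `w'`. -/
def ExpLift (s : ℂ) (V : Set ℂ) {U : Set ℂ} {x y : U} (q : Path x y) (w w' : ℂ) : Prop :=
  ∃ Q : Path w w', ∀ t, s + Complex.exp (Q t) = q t ∧ (q t : ℂ) ∈ V

/-- Two lifts with common endpoints are homotopic in the simply connected preimage; the homotopy is
pushed down by `w ↦ s + exp w`, which never takes the value `s`. -/
theorem ExpLift.homotopic (hV : StarConvex ℝ s V) {ρ : ℝ} (hρ : 0 < ρ)
    (hb : Metric.ball s ρ ⊆ V) (hVU : ∀ z ∈ V, z ≠ s → z ∈ U) {x y : U} {p q : Path x y}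
    {w w' : ℂ} (hp : ExpLift s V p w w') (hq : ExpLift s V q w w') : p.Homotopic q := by
  obtain ⟨P, hP⟩ := hp
  obtain ⟨Q, hQ⟩ := hq
  have := simplyConnectedSpace_preimage_exp hV hρ hb
  let E : Set ℂ := {w | s + Complex.exp w ∈ V}
  let e : C(E, U) := ⟨fun w => ⟨s + Complex.exp w.1, hVU _ w.2 (by simp)⟩, by fun_prop⟩
  have hPE : ∀ t, P t ∈ E := fun t => by
    simp only [E, mem_ofPred_eq, (hP t).1, (hP t).2]
  have hQE : ∀ t, Q t ∈ E := fun t => by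
    simp only [E, mem_ofPred_eq, (hQ t).1, (hQ t).2]
  have hw : w ∈ E := by simpa using hPE 0
  have hw' : w' ∈ E := by simpa using hPE 1
  let P' : Path (⟨w, hw⟩ : E) ⟨w', hw'⟩ :=
    ⟨⟨fun t => ⟨P t, hPE t⟩, by fun_prop⟩, by simp, by simp⟩
  let Q' : Path (⟨w, hw⟩ : E) ⟨w', hw'⟩ :=
    ⟨⟨fun t => ⟨Q t, hQE t⟩, by fun_prop⟩, by simp, by simp⟩
  exact homotopic_of_factor e P' Q' (fun t => Subtype.ext (hP t).1) fun t => Subtype.ext (hQ t).1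

theorem exists_path_of_exp (hV : StarConvex ℝ s V) {ρ : ℝ} (hρ : 0 < ρ)
    (hb : Metric.ball s ρ ⊆ V) (hVU : ∀ z ∈ V, z ≠ s → z ∈ U) (x y : U) (hx : x.1 ∈ V)
    (hy : y.1 ∈ V) (hxs : x.1 ≠ s) (hys : y.1 ≠ s) : ∃ q : Path x y, ∀ t, (q t : ℂ) ∈ V := by
  have := simplyConnectedSpace_preimage_exp hV hρ hb
  let E : Set ℂ := {w | s + Complex.exp w ∈ V}
  let e : C(E, U) := ⟨fun w => ⟨s + Complex.exp w.1, hVU _ w.2 (by simp)⟩, by fun_prop⟩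
  have hlog : ∀ z : ℂ, z ≠ s → s + Complex.exp (Complex.log (z - s)) = z := fun z hz => by
    rw [Complex.exp_log (sub_ne_zero.2 hz), add_sub_cancel]
  let P := PathConnectedSpace.somePath
    (⟨Complex.log (x - s), show _ ∈ V by rwa [hlog _ hxs]⟩ : E)
    ⟨Complex.log (y - s), show _ ∈ V by rwa [hlog _ hys]⟩
  refine ⟨(P.map e.continuous).cast (Subtype.ext (hlog _ hxs).symm)
    (Subtype.ext (hlog _ hys).symm), fun t => (P t).2⟩

theorem exists_expLift (hs : s ∉ U) {x y : U} (q : Path x y) (hq : ∀ t, (q t : ℂ) ∈ V) {w : ℂ}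
    (hw : Complex.exp w = x - s) : ∃ w', ExpLift s V q w w' := by
  have hne : ∀ t, (q t : ℂ) - s ≠ 0 := fun t => sub_ne_zero.2 fun h => hs (h ▸ (q t).2)
  let f : C(unitInterval, {z : ℂ // z ≠ 0}) := ⟨fun t => ⟨q t - s, hne t⟩, by fun_prop⟩
  obtain ⟨Q, hQ, hQ0⟩ := Complex.isCoveringMap_exp.exists_path_lifts f w
    (Subtype.ext (by simp [f, hw]))
  refine ⟨Q 1, ⟨Q, hQ0, rfl⟩, fun t => ⟨?_, hq t⟩⟩
  have := congrArg Subtype.val (congrFun hQ t)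
  simp only [Function.comp_apply, f, ContinuousMap.coe_mk] at this
  change s + Complex.exp (Q t) = q t
  rw [this, add_sub_cancel]

theorem ExpLift.exp_target {x y : U} {q : Path x y} {w w' : ℂ} (h : ExpLift s V q w w') :
    Complex.exp w' = y - s := by
  obtain ⟨Q, hQ⟩ := h
  have := (hQ 1).1
  rw [Q.target, q.target] at this
  rw [← this, add_sub_cancel_left]

theorem ExpLift.trans {x y z : U} {p : Path x y} {q : Path y z} {w w' w'' : ℂ}
    (hp : ExpLift s V p w w') (hq : ExpLift s V q w' w'') : ExpLift s V (p.trans q) w w'' := by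
  obtain ⟨P, hP⟩ := hp
  obtain ⟨Q, hQ⟩ := hq
  refine ⟨P.trans Q, fun t => ?_⟩
  simp only [Path.trans_apply]
  split_ifs
  · exact hP _
  · exact hQ _

theorem ExpLift.symm {x y : U} {p : Path x y} {w w' : ℂ} (hp : ExpLift s V p w w') :
    ExpLift s V p.symm w' w := by
  obtain ⟨P, hP⟩ := hp
  exact ⟨P.symm, fun t => hP _⟩

theorem ExpLift.translate {x y : U} {p : Path x y} {w w' : ℂ} (hp : ExpLift s V p w w') (n : ℤ) :
    ExpLift s V p (w + n * (2 * Real.pi * Complex.I)) (w' + n * (2 * Real.pi * Complex.I)) := by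
  obtain ⟨P, hP⟩ := hp
  refine ⟨⟨⟨fun t => P t + n * (2 * Real.pi * Complex.I), by fun_prop⟩, by simp, by simp⟩,
    fun t => ⟨?_, (hP t).2⟩⟩
  rw [← (hP t).1]
  exact congrArg (s + ·) (Complex.exp_periodic.int_mul n (P t))

theorem ExpLift.congr {x y : U} {p : Path x y} {w w' v v' : ℂ} (hp : ExpLift s V p w w')
    (h : w = v) (h' : w' = v') : ExpLift s V p v v' := h ▸ h' ▸ hp

theorem ExpLift.loopPow {x : U} {p : Path x x} {w : ℂ}
    (hp : ExpLift s V p w (w + 2 * Real.pi * Complex.I)) (n : ℤ) :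
    ExpLift s V (loopPow p n) w (w + n * (2 * Real.pi * Complex.I)) := by
  have hw : s + Complex.exp w = x ∧ (x : ℂ) ∈ V := by
    obtain ⟨P, hP⟩ := hp
    simpa using hP 0
  have key : ∀ (q : Path x x) (k : ℤ),
      ExpLift s V q w (w + k * (2 * Real.pi * Complex.I)) → ∀ n : ℕ,
      ExpLift s V (concat (List.replicate n q)) w
        (w + (n * k : ℤ) * (2 * Real.pi * Complex.I)) := by
    intro q k hq n
    induction n with
    | zero =>
      simp only [CharP.cast_eq_zero, zero_mul, Int.cast_zero, add_zero]
      exact ⟨Path.refl w, fun t => hw⟩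
    | succ n ih =>
      exact (hq.trans (ih.translate k)).congr rfl (by push_cast; ring)
  rcases n with n | n
  · exact (key p 1 (hp.congr rfl (by simp)) n).congr rfl (by simp)
  · refine (key p.symm (-1) ?_ (n + 1)).congr rfl ?_
    · exact (hp.symm.translate (-1)).congr (by push_cast; ring) rfl
    · rw [Int.negSucc_eq]
      push_cast
      ring

theorem ExpLift.conjLoop {x y : U} {γ : Path x y} {c : Path y y} {w w' : ℂ}
    (hγ : ExpLift s V γ w w') (hc : ExpLift s V c w' (w' + 2 * Real.pi * Complex.I)) :
    ExpLift s V (conjLoop γ c) w (w + 2 * Real.pi * Complex.I) := by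
  have := hγ.symm.translate 1
  simp only [Int.cast_one, one_mul] at this
  exact (hγ.trans hc).trans this

/-- Around an isolated point of the complement of `U`, every loop is homotopic to a power of a
given meridian. -/
theorem exists_homotopic_loopPow (hV : StarConvex ℝ s V) {ρ : ℝ} (hρ : 0 < ρ)
    (hb : Metric.ball s ρ ⊆ V) (hVU : ∀ z ∈ V, z ≠ s → z ∈ U) (hs : s ∉ U) {x : U} {p : Path x x}
    {w : ℂ} (hp : ExpLift s V p w (w + 2 * Real.pi * Complex.I)) (σ : Path x x)
    (hσ : ∀ t, (σ t : ℂ) ∈ V) : ∃ n : ℤ, σ.Homotopic (ContourRep.loopPow p n) := by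
  have hw : Complex.exp w = x - s := by
    rw [← hp.exp_target, Complex.exp_periodic w]
  obtain ⟨w', hw'⟩ := exists_expLift (V := V) hs σ hσ hw
  obtain ⟨n, rfl⟩ := Complex.exp_eq_exp_iff_exists_int.1 (hw'.exp_target.trans hw.symm)
  exact ⟨n, hw'.homotopic hV hρ hb hVU (hp.loopPow n)⟩

end ExpLift

/-! ### The finitely punctured plane. -/

section Planar

theorem Convex.homotopic_of_subset {U W : Set ℂ} (hW : Convex ℝ W) (hWU : W ⊆ U) {x y : U}
    {p q : Path x y} (hp : ∀ t, (p t : ℂ) ∈ W) (hq : ∀ t, (q t : ℂ) ∈ W) : p.Homotopic q := by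
  have hx : (x : ℂ) ∈ W := by simpa using hp 0
  have hy : (y : ℂ) ∈ W := by simpa using hp 1
  have : ContractibleSpace W := hW.contractibleSpace ⟨_, hx⟩
  let P : Path (⟨x, hx⟩ : W) ⟨y, hy⟩ := ⟨⟨fun t => ⟨p t, hp t⟩, by fun_prop⟩, by simp, by simp⟩
  let Q : Path (⟨x, hx⟩ : W) ⟨y, hy⟩ := ⟨⟨fun t => ⟨q t, hq t⟩, by fun_prop⟩, by simp, by simp⟩
  exact homotopic_of_factor (⟨inclusion hWU, by fun_prop⟩ : C(W, U)) P Q (fun _ => rfl)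
    fun _ => rfl

theorem exists_convex_isOpen_inter_subset_segment {F : Set ℂ} (hF : F.Finite) (x y : ℂ) :
    ∃ W : Set ℂ, IsOpen W ∧ Convex ℝ W ∧ x ∈ W ∧ y ∈ W ∧ W ∩ F ⊆ segment ℝ x y := by
  have hK : IsCompact (segment ℝ x y) := by
    rw [segment_eq_image_lineMap]
    exact isCompact_Icc.image AffineMap.lineMap_continuous
  have ho : IsOpen (F \ segment ℝ x y)ᶜ := (hF.subset sdiff_subset).isClosed.isOpen_compl
  obtain ⟨δ, hδ, hsub⟩ := hK.exists_thickening_subset_open ho fun z hz h => h.2 hz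
  have hself := Metric.self_subset_thickening hδ (segment ℝ x y)
  refine ⟨_, Metric.isOpen_thickening, (convex_segment x y).thickening δ,
    hself (left_mem_segment ℝ x y), hself (right_mem_segment ℝ x y), fun z hz => ?_⟩
  by_contra h
  exact hsub hz.1 ⟨hz.2, h⟩

theorem exists_ball_isolating {ι : Type*} [Finite ι] (s : ι → ℂ) (j : ι) :
    ∃ R > 0, ∀ k, s k ∈ Metric.ball (s j) R → s k = s j := by
  have ho : IsOpen (range s \ {s j})ᶜ := ((finite_range s).subset sdiff_subset).isClosed.isOpen_compl
  obtain ⟨R, hR, hsub⟩ := Metric.isOpen_iff.1 ho (s j) fun h => h.2 rfl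
  refine ⟨R, hR, fun k hk => ?_⟩
  by_contra h
  exact hsub hk ⟨mem_range_self k, h⟩

/-- The punctures and the lines through two distinct ones form a finite union of null sets. -/
theorem exists_notMem_lines {ι : Type*} [Finite ι] (s : ι → ℂ) :
    ∃ o ∉ range s, ∀ j k, s j ≠ s k → o ∉ line[ℝ, s j, s k] := by
  have h₁ : ∀ᵐ o : ℂ, o ∉ range s := (finite_range s).countable.ae_notMem _
  have h₂ : ∀ᵐ o : ℂ, ∀ j k, s j ≠ s k → o ∉ line[ℝ, s j, s k] := by
    simp only [MeasureTheory.ae_all_iff]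
    intro j k _
    refine MeasureTheory.measure_eq_zero_iff_ae_notMem.1
      (MeasureTheory.Measure.addHaar_affineSubspace _ _ fun htop => ?_)
    have h := collinear_iff_finrank_le_one.1 (collinear_pair ℝ (s j) (s k))
    rw [← direction_affineSpan, htop, AffineSubspace.direction_top, finrank_top,
      Complex.finrank_real_complex] at h
    omega
  exact (h₁.and h₂).exists

/-- Two distinct punctures on a segment from `o` would span a line through `o`. -/
theorem segment_inter_subsingleton {ι : Type*} {s : ι → ℂ} {o : ℂ}
    (ho : ∀ j k, s j ≠ s k → o ∉ line[ℝ, s j, s k]) (y : ℂ) :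
    (segment ℝ o y ∩ range s).Subsingleton := by
  rintro _ ⟨hj, j, rfl⟩ _ ⟨hk, k, rfl⟩
  by_contra hne
  rw [segment_eq_image_lineMap] at hj hk
  obtain ⟨a, -, ha⟩ := hj
  obtain ⟨b, -, hb⟩ := hk
  have hab : b - a ≠ 0 := fun h => hne (by rw [← ha, ← hb, sub_eq_zero.1 h])
  apply ho j k hne
  convert AffineMap.lineMap_mem_affineSpan_pair (-a / (b - a)) (s j) (s k) using 1
  have hab' : (b : ℂ) - a ≠ 0 := by exact_mod_cast hab
  rw [← ha, ← hb]
  simp only [AffineMap.lineMap_apply, vsub_eq_sub, vadd_eq_add, Complex.real_smul]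
  push_cast
  field_simp
  ring

/-- The hypothesis on `p j` quantifies over all `V` because the same meridian must serve every
convex neighbourhood `W` that contains `s j`. -/
theorem generated_of_segment_inter_subsingleton {ι : Type*} [Finite ι] (s : ι → ℂ)
    (o : ↥(range s)ᶜ)
    (ho : ∀ y : ℂ, (segment ℝ (o : ℂ) y ∩ range s).Subsingleton)
    {R : ι → ℝ} (hR : ∀ j, 0 < R j) (hRs : ∀ j k, s k ∈ Metric.ball (s j) (R j) → s k = s j)
    {p : ι → Path o o}
    (hp : ∀ j (V : Set ℂ), StarConvex ℝ (s j) V → Metric.ball (s j) (R j) ⊆ V → (o : ℂ) ∈ V →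
      ∃ w, ExpLift (s j) V (p j) w (w + 2 * Real.pi * Complex.I)) (σ : Path o o) :
    Generated p (mk σ) := by
  have loops : ∀ W : Set ℂ, Convex ℝ W → (o : ℂ) ∈ W → (W ∩ range s).Subsingleton →
      ∀ τ : Path o o, (∀ t, (τ t : ℂ) ∈ W) → Generated p (mk τ) := by
    intro W hW hoW hsub τ hτ
    by_cases h : ∃ j, s j ∈ W
    · obtain ⟨j, hj⟩ := h
      -- The circle of `p j` need not lie in `W`; adjoining the ball makes room for it and keeps the
      -- set star-shaped about `s j`.
      have hstar : StarConvex ℝ (s j) (W ∪ Metric.ball (s j) (R j)) :=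
        (hW.starConvex hj).union
          ((convex_ball _ _).starConvex (Metric.mem_ball_self (hR j)))
      obtain ⟨w, hw⟩ := hp j _ hstar subset_union_right (Or.inl hoW)
      obtain ⟨n, hn⟩ := exists_homotopic_loopPow hstar (hR j) subset_union_right
        (fun z hz hne => by
          rintro ⟨k, rfl⟩
          rcases hz with hz | hz
          · exact hne (hsub ⟨hz, mem_range_self k⟩ ⟨hj, mem_range_self j⟩)
          · exact hne (hRs j k hz))
        (not_not_intro (mem_range_self j)) hw τ fun t => Or.inl (hτ t)
      rw [Path.Homotopic.Quotient.eq.2 hn]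
      exact (Generated.of j).loopPow n
    · have hWU : W ⊆ (range s)ᶜ := by
        rintro z hz ⟨k, rfl⟩
        exact h ⟨k, hz⟩
      rw [Path.Homotopic.Quotient.eq.2 (Convex.homotopic_of_subset hW hWU hτ
        (q := Path.refl o) fun _ => hoW)]
      exact .refl
  have paths : ∀ W : Set ℂ, IsOpen W → Convex ℝ W → (o : ℂ) ∈ W → (W ∩ range s).Subsingleton →
      ∀ y : ↥(range s)ᶜ, (y : ℂ) ∈ W → ∃ q : Path o y, ∀ t, (q t : ℂ) ∈ W := by
    intro W hWo hW hoW hsub y hy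
    by_cases h : ∃ j, s j ∈ W
    · obtain ⟨j, hj⟩ := h
      obtain ⟨ρ, hρ, hb⟩ := Metric.isOpen_iff.1 hWo _ hj
      refine exists_path_of_exp (hW.starConvex hj) hρ hb (fun z hz hne => ?_) o y hoW hy
        (fun h => o.2 ⟨j, h.symm⟩) fun h => y.2 ⟨j, h.symm⟩
      rintro ⟨k, rfl⟩
      exact hne (hsub ⟨hz, mem_range_self k⟩ ⟨hj, mem_range_self j⟩)
    · have hWU : W ⊆ (range s)ᶜ := by
        rintro z hz ⟨k, rfl⟩
        exact h ⟨k, hz⟩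
      obtain ⟨q, hq⟩ := (hW.isPathConnected ⟨_, hoW⟩).joinedIn _ hoW _ hy
      exact ⟨⟨⟨fun t => ⟨q t, hWU (hq t)⟩, by fun_prop⟩, by simp, by simp⟩, hq⟩
  have hmem : ∀ y : ↥(range s)ᶜ, ∃ W : Set ℂ, IsOpen W ∧ Convex ℝ W ∧ (o : ℂ) ∈ W ∧
      (y : ℂ) ∈ W ∧ (W ∩ range s).Subsingleton := by
    intro y
    obtain ⟨W, hWo, hW, hoW, hyW, hsub⟩ :=
      exists_convex_isOpen_inter_subset_segment (finite_range s) (o : ℂ) y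
    exact ⟨W, hWo, hW, hoW, hyW, (ho y).anti fun z hz => ⟨hsub hz, hz.2⟩⟩
  choose W hWo hW hoW hyW hsub using hmem
  choose q hq using fun y => paths (W y) (hWo y) (hW y) (hoW y) (hsub y) y (hyW y)
  have key := Generated.of_local (c := p) q (fun y => ⟨Subtype.val ⁻¹' W y,
    ((hWo y).preimage continuous_subtype_val).mem_nhds (hyW y), fun z f hf => ?_⟩) σ
  -- The tie `q o` need not be constant, but it is itself a generated loop and can be cancelled.
  · have ho' := loops (W o) (hW o) (hoW o) (hsub o) (q o) (hq o)
    have := (ho'.symm.trans key).trans ho'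
    simpa only [Quotient.trans_assoc, symm_trans_cancel, Quotient.symm_trans,
      Quotient.trans_refl] using this
  · have hz : (z : ℂ) ∈ W y := by
      have := hf (mem_range_self 1)
      rwa [f.target] at this
    -- A path `r` in both neighbourhoods splits the loop `q y · f · (q z)⁻¹` into one loop in `W y`
    -- and one in `W z`.
    obtain ⟨r, hr⟩ := paths (W y ∩ W z) ((hWo y).inter (hWo z)) ((hW y).inter (hW z))
      ⟨hoW y, hoW z⟩ ((hsub y).anti (inter_subset_inter_left _ inter_subset_left)) z ⟨hz, hyW z⟩
    have h₁ := loops (W y) (hW y) (hoW y) (hsub y) (((q y).trans f).trans r.symm) fun t => by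
      have : range (((q y).trans f).trans r.symm) ⊆ Subtype.val ⁻¹' W y := by
        rw [Path.trans_range, Path.trans_range, Path.symm_range]
        refine union_subset (union_subset ?_ hf) ?_
        · rintro _ ⟨t, rfl⟩
          exact hq y t
        · rintro _ ⟨t, rfl⟩
          exact (hr t).1
      exact this (mem_range_self t)
    have h₂ := loops (W z) (hW z) (hoW z) (hsub z) (r.trans (q z).symm) fun t => by
      have : range (r.trans (q z).symm) ⊆ Subtype.val ⁻¹' W z := by
        rw [Path.trans_range, Path.symm_range]
        refine union_subset ?_ ?_
        · rintro _ ⟨t, rfl⟩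
          exact (hr t).2
        · rintro _ ⟨t, rfl⟩
          exact hq z t
      exact this (mem_range_self t)
    simpa only [Quotient.mk_trans, Quotient.mk_symm, Quotient.trans_assoc, symm_trans_cancel]
      using h₁.trans h₂

/-- The fundamental group of the plane minus finitely many points is generated by small circles
around these points, joined to the base point. -/
theorem exists_meridians_generate {ι : Type*} [Finite ι] (s : ι → ℂ) (a : ↥(range s)ᶜ) {ε : ℝ} (hε : 0 < ε) :
    ∃ (b : ι → ↥(range s)ᶜ) (γ : ∀ j, Path a (b j)) (c : ∀ j, Path (b j) (b j)),
      (∀ j, ‖(b j : ℂ) - s j‖ < ε ∧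
        (∀ k, s k ≠ s j → ‖(b j : ℂ) - s j‖ < ‖s k - s j‖) ∧
        ∀ t, (c j t : ℂ) - s j =
          ((b j : ℂ) - s j) * Complex.exp (2 * Real.pi * Complex.I * ((t : ℝ) : ℂ))) ∧
      ∀ σ : Path a a, Generated (fun j => conjLoop (γ j) (c j)) (mk σ) := by
  obtain ⟨o, hos, holine⟩ := exists_notMem_lines s
  choose R hR hRs using exists_ball_isolating s
  have hos' : ∀ j, o - s j ≠ 0 := fun j h => hos ⟨j, (sub_eq_zero.1 h).symm⟩
  have hL : ∀ j, ∃ L : ℝ, L ≤ 0 ∧ Real.exp L * ‖o - s j‖ < min ε (R j) := by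
    intro j
    have hδ : 0 < min ε (R j) := lt_min hε (hR j)
    have hd : 0 < ‖o - s j‖ := norm_pos_iff.2 (hos' j)
    -- With `m = min ε (R j)` and `d = ‖o - s j‖`, the radius is `m d / (m + d) < m`. Since `L ≤ 0`,
    -- the ray from `o` runs towards `s j`, so it stays in every star-shaped `V` containing `o`.
    refine ⟨Real.log (min ε (R j) / (min ε (R j) + ‖o - s j‖)),
      Real.log_nonpos (by positivity) ?_, ?_⟩
    · rw [div_le_one (by positivity)]
      linarith
    · rw [Real.exp_log (by positivity), div_mul_eq_mul_div, div_lt_iff₀ (by positivity)]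
      nlinarith
  choose L hL0 hLR using hL
  have hne : ∀ j w, s j + Complex.exp w * (o - s j) ≠ s j := fun j w h =>
    mul_ne_zero (Complex.exp_ne_zero w) (hos' j) (add_eq_left.1 h)
  have hray : ∀ j (τ : ℝ), s j + Complex.exp τ * (o - s j) ∈ (range s)ᶜ := by
    rintro j τ ⟨k, hk⟩
    have hjk : s j ≠ s k := fun h => hne j τ (by rw [← hk, h])
    apply holine j k hjk
    convert AffineMap.lineMap_mem_affineSpan_pair (Real.exp (-τ)) (s j) (s k) using 1
    rw [hk, AffineMap.lineMap_apply, vsub_eq_sub, vadd_eq_add, add_sub_cancel_left,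
      Complex.real_smul, ← mul_assoc, Complex.ofReal_exp, ← Complex.exp_add]
    simp
  have hball : ∀ j (θ : ℝ), s j + Complex.exp (L j + θ * Complex.I) * (o - s j) ∈
      Metric.ball (s j) (R j) := by
    intro j θ
    rw [Metric.mem_ball, dist_eq_norm, add_sub_cancel_left, norm_mul, Complex.norm_exp]
    simpa using (hLR j).trans_le (min_le_right _ _)
  have hcirc : ∀ j (θ : ℝ), s j + Complex.exp (L j + θ * Complex.I) * (o - s j) ∈
      (range s)ᶜ := by
    rintro j θ ⟨k, hk⟩
    exact hne j _ (hk ▸ hRs j k (hk ▸ hball j θ))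
  let o' : ↥(range s)ᶜ := ⟨o, hos⟩
  let b : ι → ↥(range s)ᶜ := fun j => ⟨_, hray j (L j)⟩
  let γ : ∀ j, Path o' (b j) := fun j =>
    ⟨⟨fun t => ⟨s j + Complex.exp ((t * L j : ℝ) : ℂ) * (o - s j), hray j _⟩, by fun_prop⟩,
      by simp [o'], by simp [b]⟩
  let c : ∀ j, Path (b j) (b j) := fun j =>
    ⟨⟨fun t => ⟨s j + Complex.exp (L j + ((2 * Real.pi * t : ℝ) : ℂ) * Complex.I) * (o - s j),
      hcirc j _⟩, by fun_prop⟩, by simp [b], by simp [b, Complex.exp_add]⟩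
  have hgen : ∀ σ : Path o' o', Generated (fun j => conjLoop (γ j) (c j)) (mk σ) := by
    refine generated_of_segment_inter_subsingleton s o' (segment_inter_subsingleton holine) hR hRs
      fun j V hV hb ho => ?_
    have hexp : Complex.exp (Complex.log (o - s j)) = o - s j := Complex.exp_log (hos' j)
    -- The lift goes horizontally by `L j` along the ray, then vertically by `2πi` around the
    -- circle.
    refine ⟨Complex.log (o - s j), ExpLift.conjLoop (w' := Complex.log (o - s j) + L j)
      ⟨⟨⟨fun t => Complex.log (o - s j) + (t * L j : ℝ), by fun_prop⟩, by simp, by simp⟩,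
        fun t => ⟨?_, ?_⟩⟩
      ⟨⟨⟨fun t => Complex.log (o - s j) + L j + (2 * Real.pi * t : ℝ) * Complex.I, by fun_prop⟩,
        by simp, by simp⟩, fun t => ⟨?_, hb (hball j _)⟩⟩⟩
    · change s j + Complex.exp (Complex.log (o - s j) + _) = _
      rw [Complex.exp_add, hexp, mul_comm]
      rfl
    · have h := add_exp_sub_mem hV (w := Complex.log (o - s j)) (τ := -(t * L j))
        (by rw [hexp]; simpa using ho)
        (neg_nonneg.2 (mul_nonpos_of_nonneg_of_nonpos t.2.1 (hL0 j)))
      convert h using 1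
      rw [Complex.ofReal_neg, sub_neg_eq_add, Complex.exp_add, hexp, mul_comm]
      rfl
    · change s j + Complex.exp (Complex.log (o - s j) + L j + _) = _
      rw [add_assoc, Complex.exp_add, hexp, mul_comm]
      rfl
  have : PathConnectedSpace ↥(range s)ᶜ := isPathConnected_iff_pathConnectedSpace.1
    ((finite_range s).countable.isPathConnected_compl_of_one_lt_rank
      (by rw [Complex.rank_real_complex]; exact Nat.one_lt_ofNat))
  let δ : Path a o' := PathConnectedSpace.somePath a o'
  have hnorm : ∀ j, ‖(b j : ℂ) - s j‖ = Real.exp (L j) * ‖o - s j‖ := by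
    intro j
    rw [add_sub_cancel_left, norm_mul, Complex.norm_exp, Complex.ofReal_re]
  refine ⟨b, fun j => δ.trans (γ j), c, fun j => ⟨?_, fun k hk => ?_, fun t => ?_⟩, fun σ => ?_⟩
  · rw [hnorm]
    exact (hLR j).trans_le (min_le_left _ _)
  · rw [hnorm, ← dist_eq_norm (s k)]
    refine (hLR j).trans_le ((min_le_right _ _).trans ?_)
    by_contra h
    exact hk (hRs j k (not_le.1 h))
  · simp only [c, b, Path.coe_mk', ContinuousMap.coe_mk, add_sub_cancel_left, Complex.exp_add]
    push_cast
    ring_nf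
  -- Conjugation by `δ` respects products and inverses and carries the generators at `o` to those at
  -- `a`.
  · have := Generated.hom (d := fun j => conjLoop (δ.trans (γ j)) (c j))
      (fun q : Quotient o' o' => ((mk δ).trans q).trans (mk δ).symm) ?_ ?_ ?_ ?_
      (hgen ((δ.symm.trans σ).trans δ))
    · simpa only [Quotient.mk_trans, Quotient.mk_symm, Quotient.trans_assoc, trans_symm_cancel,
        Quotient.trans_symm, Quotient.trans_refl] using this
    · simp only [Quotient.trans_refl, Quotient.trans_symm]
    · intro p q
      simp only [Quotient.trans_assoc, symm_trans_cancel]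
    · intro p
      simp only [symm_trans_rev, symm_symm_quotient, Quotient.trans_assoc]
    · intro j
      have h := Generated.of (c := fun j => conjLoop (δ.trans (γ j)) (c j)) j
      simpa only [mk_conjLoop, Quotient.mk_trans, symm_trans_rev, Quotient.trans_assoc] using h

end Planar

/-! ### Splitting the complement of the lines into two punctured planes. -/

section CharCoord

/-- The point of `ℂ²` with given characteristic coordinates. -/
noncomputable def ofCharCoord (u v : ℂ) : ℂ × ℂ := ((u + v) / 2, (u - v) / (2 * Complex.I))

theorem charCoord_zero_ofCharCoord (u v : ℂ) : charCoord 0 (ofCharCoord u v) = u := by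
  simp only [charCoord, ofCharCoord, if_true]
  field_simp
  ring

theorem charCoord_one_ofCharCoord (u v : ℂ) : charCoord 1 (ofCharCoord u v) = v := by
  simp only [charCoord, ofCharCoord, one_ne_zero, if_false]
  field_simp
  ring

theorem ofCharCoord_charCoord (x : ℂ × ℂ) : ofCharCoord (charCoord 0 x) (charCoord 1 x) = x := by
  simp only [charCoord, ofCharCoord, one_ne_zero, if_true, if_false]
  ext
  · ring
  · field_simp
    ring

theorem continuous_charCoord (l : Fin 2) : Continuous (charCoord l) := by
  unfold charCoord
  split_ifs <;> fun_prop

variable {N : ℕ} (P : Fin N → ℝ × ℝ)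

/-- The characteristic coordinate `l` of the point with index `j`. -/
noncomputable def branchCoord (l : Fin 2) (j : Fin N) : ℂ := charCoord l (realPoint (P j))

/-- For a real point, the real and imaginary parts of either characteristic coordinate are its real
coordinates up to sign. -/
theorem eq_of_branchCoord_eq (l : Fin 2) {j k : Fin N}
    (h : branchCoord P l k = branchCoord P l j) : P k = P j := by
  have h₁ := congrArg Complex.re h
  have h₂ := congrArg Complex.im h
  fin_cases l <;> simp [branchCoord, charCoord, realPoint] at h₁ h₂ <;> exact Prod.ext h₁ h₂

theorem mem_compl_branchSet {x : ℂ × ℂ} :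
    x ∈ (branchSet P)ᶜ ↔ ∀ l, charCoord l x ∈ (range (branchCoord P l))ᶜ := by
  simp only [branchSet, branchLine, branchCoord, mem_compl_iff, mem_iUnion, mem_range,
    mem_ofPred_eq, not_exists, eq_comm]

/-- The product of the two punctured planes of characteristic coordinates parametrizes the
complement of the lines. -/
noncomputable def ofCharCoordMap :
    C(↥(range (branchCoord P 0))ᶜ × ↥(range (branchCoord P 1))ᶜ, ↥(branchSet P)ᶜ) where
  toFun z := ⟨ofCharCoord z.1 z.2, (mem_compl_branchSet P).2 fun l => by
    fin_cases l
    · exact (charCoord_zero_ofCharCoord _ _).symm ▸ z.1.2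
    · exact (charCoord_one_ofCharCoord _ _).symm ▸ z.2.2⟩
  continuous_toFun := by
    unfold ofCharCoord
    fun_prop

theorem exists_ofCharCoordMap_eq (A : ↥(branchSet P)ᶜ) : ∃ u v, ofCharCoordMap P (u, v) = A :=
  ⟨⟨_, (mem_compl_branchSet P).1 A.2 0⟩, ⟨_, (mem_compl_branchSet P).1 A.2 1⟩,
    Subtype.ext (ofCharCoord_charCoord A.1)⟩

/-- The slice `v = const`. -/
noncomputable def sliceZero (v : ↥(range (branchCoord P 1))ᶜ) :
    C(↥(range (branchCoord P 0))ᶜ, ↥(branchSet P)ᶜ) :=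
  (ofCharCoordMap P).comp ⟨fun u => (u, v), by fun_prop⟩

/-- The slice `u = const`. -/
noncomputable def sliceOne (u : ↥(range (branchCoord P 0))ᶜ) :
    C(↥(range (branchCoord P 1))ᶜ, ↥(branchSet P)ᶜ) :=
  (ofCharCoordMap P).comp ⟨fun v => (u, v), by fun_prop⟩

/-- In the product, `(σ₀, σ₁)` is homotopic to `(σ₀ · refl, refl · σ₁)`, which is the concatenation
of the two slice loops. -/
theorem exists_mk_eq_slices {u : ↥(range (branchCoord P 0))ᶜ} {v : ↥(range (branchCoord P 1))ᶜ}
    (σ : Path (ofCharCoordMap P (u, v)) (ofCharCoordMap P (u, v))) :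
    ∃ (σ₀ : Path u u) (σ₁ : Path v v),
      mk σ = ((mk σ₀).map (sliceZero P v)).trans ((mk σ₁).map (sliceOne P u)) := by
  have hc := continuous_charCoord
  let σ₀ : Path u u :=
    ⟨⟨fun t => ⟨charCoord 0 (σ t).1, (mem_compl_branchSet P).1 (σ t).2 0⟩, by fun_prop⟩,
      Subtype.ext ((congrArg (fun x => charCoord 0 x.1) σ.source).trans
        (charCoord_zero_ofCharCoord _ _)),
      Subtype.ext ((congrArg (fun x => charCoord 0 x.1) σ.target).trans
        (charCoord_zero_ofCharCoord _ _))⟩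
  let σ₁ : Path v v :=
    ⟨⟨fun t => ⟨charCoord 1 (σ t).1, (mem_compl_branchSet P).1 (σ t).2 1⟩, by fun_prop⟩,
      Subtype.ext ((congrArg (fun x => charCoord 1 x.1) σ.source).trans
        (charCoord_one_ofCharCoord _ _)),
      Subtype.ext ((congrArg (fun x => charCoord 1 x.1) σ.target).trans
        (charCoord_one_ofCharCoord _ _))⟩
  refine ⟨σ₀, σ₁, ?_⟩
  have h : (σ₀.prod σ₁).Homotopic
      ((σ₀.prod (Path.refl v)).trans ((Path.refl u).prod σ₁)) := by
    rw [Path.trans_prod_eq_prod_trans]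
    have h₀ : σ₀.Homotopic (σ₀.trans (Path.refl u)) := ⟨(Path.Homotopy.transRefl σ₀).symm⟩
    have h₁ : σ₁.Homotopic ((Path.refl v).trans σ₁) := ⟨(Path.Homotopy.reflTrans σ₁).symm⟩
    exact h₀.map2 Path.Homotopic.prodHomotopy h₁
  have h' := h.map (ofCharCoordMap P)
  rw [Path.map_trans] at h'
  have hσ : (σ₀.prod σ₁).map (ofCharCoordMap P).continuous = σ :=
    Path.ext (funext fun t => Subtype.ext (ofCharCoord_charCoord _))
  rw [hσ] at h'
  exact Path.Homotopic.Quotient.eq.2 h'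

theorem charCoord_zero_sliceZero (u : ↥(range (branchCoord P 0))ᶜ)
    (v : ↥(range (branchCoord P 1))ᶜ) : charCoord 0 (sliceZero P v u).1 = u :=
  charCoord_zero_ofCharCoord _ _

theorem charCoord_one_sliceZero (u : ↥(range (branchCoord P 0))ᶜ)
    (v : ↥(range (branchCoord P 1))ᶜ) : charCoord 1 (sliceZero P v u).1 = v :=
  charCoord_one_ofCharCoord _ _

theorem charCoord_zero_sliceOne (u : ↥(range (branchCoord P 0))ᶜ)
    (v : ↥(range (branchCoord P 1))ᶜ) : charCoord 0 (sliceOne P u v).1 = u :=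
  charCoord_zero_ofCharCoord _ _

theorem charCoord_one_sliceOne (u : ↥(range (branchCoord P 0))ᶜ)
    (v : ↥(range (branchCoord P 1))ᶜ) : charCoord 1 (sliceOne P u v).1 = v :=
  charCoord_one_ofCharCoord _ _

theorem isMeridian_of_charCoord {l : Fin 2} {B : ↥(branchSet P)ᶜ} {c : Path B B} {j : Fin N}
    {ε : ℝ} {b : ℂ} {z : unitInterval → ℂ} (hb : charCoord l B.1 = b)
    (hz : ∀ t, charCoord l (c t).1 = z t)
    (hc : ∀ t, charCoord (1 - l) (c t).1 = charCoord (1 - l) B.1)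
    (h : ‖b - branchCoord P l j‖ < ε ∧
      (∀ k, branchCoord P l k ≠ branchCoord P l j →
        ‖b - branchCoord P l j‖ < ‖branchCoord P l k - branchCoord P l j‖) ∧
      ∀ t, z t - branchCoord P l j =
        (b - branchCoord P l j) * Complex.exp (2 * Real.pi * Complex.I * ((t : ℝ) : ℂ))) :
    IsMeridian P ε l j c := by
  subst hb
  refine ⟨h.1, fun k hk => h.2.1 k fun he => hk (eq_of_branchCoord_eq P l he),
    fun t => ⟨?_, hc t⟩⟩
  have := h.2.2 t
  rwa [← hz t] at this

theorem Generated.map {X Y ι κ : Type*} [TopologicalSpace X] [TopologicalSpace Y] {x : X}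
    {c : ι → Path x x} (f : C(X, Y)) {d : κ → Path (f x) (f x)}
    (h : ∀ i, Generated d (mk ((c i).map f.continuous))) {q : Quotient x x}
    (hq : Generated c q) : Generated d (q.map f) := by
  refine Generated.hom (fun q => q.map f) ?_ ?_ ?_ h hq
  · rfl
  · intro p q
    induction p with | mk p =>
    induction q with | mk q =>
    rw [← Quotient.mk_trans, ← Quotient.mk_map, Path.map_trans]
    rfl
  · intro p
    induction p with | mk p =>
    rw [← Quotient.mk_symm, ← Quotient.mk_map, ← Path.map_symm]
    rfl

end CharCoord

end ContourRep

/-! ### Assembly of the main theorem. -/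

open ContourRep
open Path.Homotopic.Quotient (mk)


theorem mainTheorem6 (N : ℕ) (hN : 0 < N) (P : Fin N → ℝ × ℝ)
    (A : ↥(ContourRep.branchSet P)ᶜ) (ε : ℝ) (hε : 0 < ε) :
    ∃ (B : Fin 2 → Fin N → ↥(ContourRep.branchSet P)ᶜ)
      (γ : ∀ (l : Fin 2) (j : Fin N), Path A (B l j))
      (c : ∀ (l : Fin 2) (j : Fin N), Path (B l j) (B l j)),
      (∀ (l : Fin 2) (j : Fin N), ContourRep.IsMeridian P ε l j (c l j)) ∧
      (∀ (j : Fin N) (t : unitInterval),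
        (ContourRep.conjLoop (γ 0 j) (c 0 j) t).1.1
            - Complex.I * (ContourRep.conjLoop (γ 0 j) (c 0 j) t).1.2
          = A.1.1 - Complex.I * A.1.2) ∧
      (∀ (j : Fin N) (t : unitInterval),
        (ContourRep.conjLoop (γ 1 j) (c 1 j) t).1.1
            + Complex.I * (ContourRep.conjLoop (γ 1 j) (c 1 j) t).1.2
          = A.1.1 + Complex.I * A.1.2) ∧
      ∀ σ : Path A A,
        ∃ (H : ℕ) (α : Fin H → Fin 2 × Fin N) (m : Fin H → ℤ), 0 < H ∧
          σ.Homotopic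
            (ContourRep.concat (List.ofFn fun h : Fin H =>
              ContourRep.loopPow
                (ContourRep.conjLoop (γ (α h).1 (α h).2) (c (α h).1 (α h).2)) (m h))) := by
  obtain ⟨u, v, rfl⟩ := exists_ofCharCoordMap_eq P A
  obtain ⟨b₀, γ₀, c₀, h₀, g₀⟩ := exists_meridians_generate (branchCoord P 0) u hε
  obtain ⟨b₁, γ₁, c₁, h₁, g₁⟩ := exists_meridians_generate (branchCoord P 1) v hε
  let B : Fin 2 → Fin N → ↥(branchSet P)ᶜ := fun l j => match l with
    | 0 => sliceZero P v (b₀ j)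
    | 1 => sliceOne P u (b₁ j)
  let γ : ∀ (l : Fin 2) (j : Fin N), Path (ofCharCoordMap P (u, v)) (B l j) := fun l j =>
    match l with
    | 0 => (γ₀ j).map (sliceZero P v).continuous
    | 1 => (γ₁ j).map (sliceOne P u).continuous
  let c : ∀ (l : Fin 2) (j : Fin N), Path (B l j) (B l j) := fun l j =>
    match l with
    | 0 => (c₀ j).map (sliceZero P v).continuous
    | 1 => (c₁ j).map (sliceOne P u).continuous
  have hd₀ : ∀ j, conjLoop (γ 0 j) (c 0 j) =
      (conjLoop (γ₀ j) (c₀ j)).map (sliceZero P v).continuous := fun j => conjLoop_map _ _ _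
  have hd₁ : ∀ j, conjLoop (γ 1 j) (c 1 j) =
      (conjLoop (γ₁ j) (c₁ j)).map (sliceOne P u).continuous := fun j => conjLoop_map _ _ _
  refine ⟨B, γ, c, ?_, fun j t => ?_, fun j t => ?_, fun σ => ?_⟩
  · rw [Fin.forall_fin_two]
    refine ⟨fun j => ?_, fun j => ?_⟩
    · exact isMeridian_of_charCoord P (charCoord_zero_sliceZero P _ v)
        (fun t => charCoord_zero_sliceZero P _ v) (fun t =>
          (charCoord_one_sliceZero P _ v).trans (charCoord_one_sliceZero P _ v).symm) (h₀ j)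
    · exact isMeridian_of_charCoord P (charCoord_one_sliceOne P u _)
        (fun t => charCoord_one_sliceOne P u _) (fun t =>
          (charCoord_zero_sliceOne P u _).trans (charCoord_zero_sliceOne P u _).symm) (h₁ j)
  · rw [hd₀]
    exact (charCoord_one_sliceZero P _ v).trans (charCoord_one_sliceZero P u v).symm
  · rw [hd₁]
    exact (charCoord_zero_sliceOne P u _).trans (charCoord_zero_sliceOne P u v).symm
  · let d : Fin 2 × Fin N → Path (ofCharCoordMap P (u, v)) (ofCharCoordMap P (u, v)) :=
      fun i => conjLoop (γ i.1 i.2) (c i.1 i.2)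
    have hσ : Generated d (mk σ) := by
      obtain ⟨σ₀, σ₁, hσ⟩ := exists_mk_eq_slices P σ
      rw [hσ]
      refine .trans (Generated.map (sliceZero P v) (d := d) (fun j => ?_) (g₀ σ₀))
        (Generated.map (sliceOne P u) (d := d) (fun j => ?_) (g₁ σ₁))
      · rw [← hd₀ j]
        exact .of (c := d) (0, j)
      · rw [← hd₁ j]
        exact .of (c := d) (1, j)
    obtain ⟨L, hL⟩ := hσ.exists_list
    -- The word `L` may be empty; a leading zeroth power, available since `0 < N`, makes the length
    -- positive.
    let M : List ((Fin 2 × Fin N) × ℤ) := ((0, ⟨0, hN⟩), 0) :: L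
    refine ⟨M.length, fun h => (M.get h).1, fun h => (M.get h).2, Nat.succ_pos _, ?_⟩
    have hM : (List.ofFn fun h => loopPow (d (M.get h).1) (M.get h).2) =
        M.map fun a => loopPow (d a.1) a.2 := by
      conv_rhs => rw [← List.ofFn_get M, List.map_ofFn]
      rfl
    change σ.Homotopic (concat (List.ofFn fun h => loopPow (d (M.get h).1) (M.get h).2))
    rw [hM, ← Path.Homotopic.Quotient.eq, hL]
    exact (Path.Homotopic.Quotient.refl_trans _).symm
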